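/- Let $k$ be a field of characteristic zero, let $n\ge 1$, let $\mathcal W=S_{n+1}$ with simple transpositions $s_i=(i,i+1)$, $1\le i\le n$, and let $\mathcal W$ act by permuting coordinates on its geometric representation $V=\{v\in k^{n+1}:\sum_x v_x=0\}$. For a reflection (transposition) $t$ let $H_t\subset V$ be the hyperplane fixed by $t$. A Weyl line is a one-dimensional subspace of $V$ that is an intersection of hyperplanes $H_t$ (the empty intersection being $V$); let $Z$ be the union of all Weyl lines, and let $V_t$ be the union of the Weyl lines not contained in $H_t$. For a word $i_1\cdots i_k$ ($k\ge1$) in $\{1,\dots,n\}$ define inductively $$W_{i}=V_{s_i},\qquad W_{i_1\cdots i_k}=V_{s_{i_1}}\cap\bigl(W_{i_2\cdots i_k}\cup s_{i_1}W_{i_2\cdots i_k}\bigr)\quad(k\ge 2).$$ Let $T(i_1\cdots i_k)$ denote the unique set $T$ of pairwise commuting reflections such that $W_{i_1\cdots i_k}=Z\cap\bigcap_{t\in T}V_t$ (for $n=1$, $T$ is moreover required to be nonempty). In the Temperley–Lieb diagram calculus on $n+1$ top points and $n+1$ bottom points, let $b_i$ be the diagram with an arc joining $i,i+1$ at the top,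 an arc joining $i,i+1$ at the bottom, and vertical lines elsewhere. Diagrams are multiplied by placing the left factor above the right one, concatenating, and removing closed circles (up to scalars). Let $Q(i_1\cdots i_k)$ be the set of transpositions $(x,y)$ such that the top points $x\neq y$ are joined by an arc in the diagram of $b_{i_1}\cdots b_{i_k}$. An element $w\in\mathcal W$ is fully commutative if any reduced expression of $w$ can be transformed into any other one using only commutation relations $st=ts$ between simple transpositions. A set $Q$ of pairwise commuting reflections is dense if it contains no two transpositions $(i,j),(k,l)$ with $i<k<j<l$ and if there are an integer $r>0$ and indices $1\le m_1<j_1<m_2<j_2<\dots<m_r<j_r\le n+1$ with $(m_q,j_q)\in Q$ for all $q$ and such that the set of points moved by elements of $Q$ is $\bigcup_{q}\{m_q,m_q+1,\dots,j_q\}$. **Proposition.** Let $w\in\mathcal W$ be fully commutative, and let $w=s_{i_1}\cdots s_{i_k}$ be a reduced expression with $k\ge1$. Then $T(i_1\cdots i_k)$ is well defined (it exists and is unique), it is dense, and $$T(i_1\cdots i_k)=Q(i_1\cdots i_k).$$ -/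

import Mathlib

/-! ### Type `A_n` combinatorics: the symmetric group on `n + 1` letters (numbered from `0`) -/

namespace WeylLines

/-- The simple transposition `s_i`, exchanging the neighbouring letters `i` and `i + 1`. -/
def simpleRefl {n : ℕ} (i : Fin n) : Equiv.Perm (Fin (n + 1)) :=
  Equiv.swap i.castSucc i.succ

/-- The product `s_{i_1} ⋯ s_{i_k}` of a word `i_1 ⋯ i_k`. -/
def wordProd {n : ℕ} (l : List (Fin n)) : Equiv.Perm (Fin (n + 1)) :=
  (l.map simpleRefl).prod

/-- `s_{i_1} ⋯ s_{i_k}` is a reduced expression: no shorter word has the same product. -/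
def IsReduced {n : ℕ} (l : List (Fin n)) : Prop :=
  ∀ l' : List (Fin n), wordProd l' = wordProd l → l.length ≤ l'.length

/-- Two words differ by one commutation relation `s t = t s` between adjacent letters. -/
def CommStep {n : ℕ} (l l' : List (Fin n)) : Prop :=
  ∃ (a b : List (Fin n)) (i j : Fin n), Commute (simpleRefl i) (simpleRefl j) ∧
    l = a ++ i :: j :: b ∧ l' = a ++ j :: i :: b

/-- `w` is fully commutative: one can pass from any reduced expression of `w` to any other one
by applying commutation relations only. -/
def IsFullyCommutative {n : ℕ} (w : Equiv.Perm (Fin (n + 1))) : Prop :=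
  ∀ l l' : List (Fin n), IsReduced l → IsReduced l' → wordProd l = w → wordProd l' = w →
    Relation.ReflTransGen CommStep l l'

/-- A set of pairwise commuting reflections (that is, transpositions). -/
def IsCommutingReflSet {n : ℕ} (Q : Set (Equiv.Perm (Fin (n + 1)))) : Prop :=
  (∀ t ∈ Q, t.IsSwap) ∧ ∀ t ∈ Q, ∀ t' ∈ Q, Commute t t'

/-- There are no `(i, j)` and `(k, l)` in `Q` with `i < k < j < l`. -/
def IsNoncrossing {n : ℕ} (Q : Set (Equiv.Perm (Fin (n + 1)))) : Prop :=
  ∀ i k j l : Fin (n + 1), i < k → k < j → j < l →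
    ¬ (Equiv.swap i j ∈ Q ∧ Equiv.swap k l ∈ Q)

/-- The union of the supports of the elements of `Q`. -/
def suppSet {n : ℕ} (Q : Set (Equiv.Perm (Fin (n + 1)))) : Set (Fin (n + 1)) :=
  {x | ∃ t ∈ Q, t x ≠ x}

/-- Dense sets of reflections: noncrossing sets of pairwise commuting reflections whose support
is a nonempty union of successive blocks `[m_q, j_q]` with `(m_q, j_q) ∈ Q`. -/
def IsDenseReflSet {n : ℕ} (Q : Set (Equiv.Perm (Fin (n + 1)))) : Prop :=
  IsCommutingReflSet Q ∧ IsNoncrossing Q ∧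
    ∃ (r : ℕ) (m j : Fin r → Fin (n + 1)), 0 < r ∧
      (∀ q, m q < j q) ∧ (∀ q q', q < q' → j q < m q') ∧
      (∀ q, Equiv.swap (m q) (j q) ∈ Q) ∧
      suppSet Q = ⋃ q, Set.Icc (m q) (j q)

/-! ### Weyl lines and the varieties attached to words -/

section Varieties

variable (k : Type*) [Field k]

/-- The geometric representation of the symmetric group on `n + 1` letters, realized as the
space of vectors with coordinate sum zero, on which permutations permute the coordinates. -/
def geomRep (n : ℕ) : Submodule k (Fin (n + 1) → k) where
  carrier := {v | ∑ x, v x = 0}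
  add_mem' := by
    intro a b ha hb
    change ∑ x, a x = 0 at ha
    change ∑ x, b x = 0 at hb
    change ∑ x, (a x + b x) = 0
    rw [Finset.sum_add_distrib, ha, hb, add_zero]
  zero_mem' := by
    change ∑ _x : Fin (n + 1), (0 : k) = 0
    simp
  smul_mem' := by
    intro c a ha
    change ∑ x, a x = 0 at ha
    change ∑ x, c * a x = 0
    rw [← Finset.mul_sum, ha, mul_zero]

/-- The action of a permutation on vectors: `(σ v)_x = v_{σ⁻¹ x}`. -/
def permAct {n : ℕ} (σ : Equiv.Perm (Fin (n + 1))) : (Fin (n + 1) → k) →ₗ[k] (Fin (n + 1) → k) :=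
  LinearMap.funLeft k k (fun x => σ⁻¹ x)

/-- The subspace of vectors of the geometric representation fixed by `t`; for a reflection `t`
this is the reflecting hyperplane `H_t`. -/
def reflHyperplane {n : ℕ} (t : Equiv.Perm (Fin (n + 1))) : Submodule k (Fin (n + 1) → k) :=
  geomRep k n ⊓ LinearMap.eqLocus (permAct k t) LinearMap.id

/-- Weyl lines: one-dimensional intersections, inside the geometric representation, of
reflecting hyperplanes. -/
def IsWeylLine {n : ℕ} (L : Submodule k (Fin (n + 1) → k)) : Prop :=
  Module.finrank k L = 1 ∧
    ∃ S : Set (Equiv.Perm (Fin (n + 1))), (∀ t ∈ S, t.IsSwap) ∧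
      L = geomRep k n ⊓ ⨅ t ∈ S, reflHyperplane k t

/-- `Z`, the union of all Weyl lines. -/
def weylUnion (n : ℕ) : Set (Fin (n + 1) → k) :=
  {v | ∃ L : Submodule k (Fin (n + 1) → k), IsWeylLine k L ∧ v ∈ L}

/-- `V_t`, the union of the Weyl lines transverse to `t`, i.e. not contained in `H_t`. -/
def transverseUnion {n : ℕ} (t : Equiv.Perm (Fin (n + 1))) : Set (Fin (n + 1) → k) :=
  {v | ∃ L : Submodule k (Fin (n + 1) → k),
    IsWeylLine k L ∧ ¬ L ≤ reflHyperplane k t ∧ v ∈ L}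

/-- The variety `W_{i_1 ⋯ i_m}` attached to a word of length at least one, with `W_i = V_i` and
`W_{i_1 ⋯ i_m} = V_{i_1} ∩ (W_{i_2 ⋯ i_m} ∪ s_{i_1} W_{i_2 ⋯ i_m})`.
The value at the empty word is not used. -/
def wordVariety {n : ℕ} : List (Fin n) → Set (Fin (n + 1) → k)
  | [] => weylUnion k n
  | [i] => transverseUnion k (simpleRefl i)
  | i :: i' :: l =>
      transverseUnion k (simpleRefl i) ∩
        (wordVariety (i' :: l) ∪ permAct k (simpleRefl i) '' wordVariety (i' :: l))

/-- `T` is the set `T_W` of the variety `W ⊆ Z`: a set of pairwise commuting reflections with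
`W = ⋂_{t ∈ T} V_t`, the intersection being taken inside `Z`. In type `A_1`, where `Z = V_{s_1}`
and so `∅` and `{s_1}` define the same variety, `T` is also required to be nonempty. -/
def IsReflSetOf {n : ℕ} (W : Set (Fin (n + 1) → k)) (T : Set (Equiv.Perm (Fin (n + 1)))) : Prop :=
  IsCommutingReflSet T ∧ W = weylUnion k n ∩ (⋂ t ∈ T, transverseUnion k t) ∧
    (n = 1 → T.Nonempty)

end Varieties

/-! ### Temperley–Lieb diagrams -/

/-- A diagram on `n + 1` top points (`Sum.inl`) and `n + 1` bottom points (`Sum.inr`), recorded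
up to isotopy by the graph on these points whose edges are the arcs. -/
abbrev Diagram (n : ℕ) := SimpleGraph (Fin (n + 1) ⊕ Fin (n + 1))

/-- The identity diagram: each top point is joined to the bottom point below it. -/
def idDiagram (n : ℕ) : Diagram n :=
  SimpleGraph.fromRel fun x y => ∃ p, x = Sum.inl p ∧ y = Sum.inr p

/-- The diagram of the generator `b_i`: one arc joins `i` and `i + 1` at the top, one arc joins
`i` and `i + 1` at the bottom, the other points are joined vertically. -/
def genDiagram {n : ℕ} (i : Fin n) : Diagram n :=
  SimpleGraph.fromRel fun x y =>
    (x = Sum.inl i.castSucc ∧ y = Sum.inl i.succ) ∨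
    (x = Sum.inr i.castSucc ∧ y = Sum.inr i.succ) ∨
    ∃ p, p ≠ i.castSucc ∧ p ≠ i.succ ∧ x = Sum.inl p ∧ y = Sum.inr p

/-- The points of a diagram `D` placed between row `a` (top points) and row `b` (bottom points)
of a three-row picture. -/
def place {n : ℕ} (a b : Fin 3) : Fin (n + 1) ⊕ Fin (n + 1) → Fin 3 × Fin (n + 1) :=
  Sum.elim (fun p => (a, p)) (fun p => (b, p))

/-- The picture obtained by drawing `D` above `E`, the bottom points of `D` being glued to the
top points of `E` (middle row). -/
def stacked {n : ℕ} (D E : Diagram n) : SimpleGraph (Fin 3 × Fin (n + 1)) :=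
  SimpleGraph.fromRel fun x y =>
    (∃ p q, D.Adj p q ∧ x = place 0 1 p ∧ y = place 0 1 q) ∨
    (∃ p q, E.Adj p q ∧ x = place 1 2 p ∧ y = place 1 2 q)

/-- Concatenation of diagrams, `D` above `E`, circles being removed: two distinct outer points
are joined by an arc when they are connected by a path in the stacked picture. -/
def concat {n : ℕ} (D E : Diagram n) : Diagram n where
  Adj p q := p ≠ q ∧ (stacked D E).Reachable (place 0 2 p) (place 0 2 q)
  symm := ⟨fun _ _ h => ⟨h.1.symm, h.2.symm⟩⟩
  loopless := ⟨fun _ h => h.1 rfl⟩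

/-- The diagram of the product `b_{i_1} ⋯ b_{i_k}` (leftmost factor on top). -/
def wordDiagram {n : ℕ} : List (Fin n) → Diagram n
  | [] => idDiagram n
  | i :: l => concat (genDiagram i) (wordDiagram l)

/-- `Q(i_1 ⋯ i_k)`: the transpositions `(x, y)` such that the top points `x` and `y` are joined
by an arc in the diagram of `b_{i_1} ⋯ b_{i_k}`. -/
def topCups {n : ℕ} (l : List (Fin n)) : Set (Equiv.Perm (Fin (n + 1))) :=
  {t | ∃ x y, (wordDiagram l).Adj (Sum.inl x) (Sum.inl y) ∧ t = Equiv.swap x y}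

end WeylLines

/-! Both sides of the equality describe the same set of two-colourings. In characteristic zero the
nonzero vectors on Weyl lines are exactly the nonzero vectors of coordinate sum zero with two
values, that is, colourings of the letters by two colours, both used (`IsWeylLine.isTwoValued`,
`IsTwoValued.isWeylLine_span`). Such a vector lies in `V_t`, `t = (x, y)`, iff it separates `x` from
`y`. Hence `Z ∩ ⋂ V_t` consists of `0` and the proper colourings of the graph with edge set `T`.

On the diagram side, multiplying by `b_i` on the left joins `i` to `i + 1` and joins their former
partners to each other (`IsMatching.concat_genDiagram`). A colouring is proper for the new cups iff
it separates `i` from `i + 1` and either it or its image under `s_i` is proper for the old cups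
(`colouring_capOff`). This is the recursion defining the varieties, so by induction the variety of a
word consists of `0` and the proper colourings of its top cups (`mem_wordVariety`).

Uniqueness holds because a partial matching is recovered from its proper colourings: two unmatched
letters can be given the same colour (`IsPartialMatching.exists_colouring`). Density comes from
planarity: a point under a top cup is itself on a cup under it (`planar_cups`), so the support is
the union of the intervals spanned by the outermost cups. -/

namespace WeylLines

/-! ### Matchings and the action of a generator -/

section CapOff

variable {α : Type*} [DecidableEq α]

/-- The matching obtained from the matching `σ` by joining the partners of `a` and `b` with each
other and `a` with `b`. -/
def capOff (a b : α) (σ : α → α) (p : α) : α :=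
  if p = a then b else if p = b then a
  else if σ p = a then σ b else if σ p = b then σ a else σ p

variable {a b : α} {σ : α → α}

theorem capOff_left : capOff a b σ a = b := by simp [capOff]

theorem capOff_right : capOff a b σ b = a := by simp +contextual [capOff, eq_comm]

theorem capOff_of_left {p : α} (ha : p ≠ a) (hb : p ≠ b) (h : σ p = a) :
    capOff a b σ p = σ b := by
  simp [capOff, *]

theorem capOff_of_right {p : α} (hab : a ≠ b) (ha : p ≠ a) (hb : p ≠ b) (h : σ p = b) :
    capOff a b σ p = σ a := by
  simp [capOff, hab.symm, *]

theorem capOff_of_ne {p : α} (ha : p ≠ a) (hb : p ≠ b) (ha' : σ p ≠ a) (hb' : σ p ≠ b) :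
    capOff a b σ p = σ p := by
  simp [capOff, *]

theorem capOff_involutive (hab : a ≠ b) (hσ : Function.Involutive σ) (hne : ∀ p, σ p ≠ p) :
    Function.Involutive (capOff a b σ) := by
  intro p
  have h := fun x => hσ x
  by_cases ha : p = a
  · rw [ha, capOff_left, capOff_right]
  by_cases hb : p = b
  · rw [hb, capOff_right, capOff_left]
  by_cases ha' : σ p = a
  · rw [capOff_of_left ha hb ha', capOff_of_right hab _ _ (h b)] <;> grind
  by_cases hb' : σ p = b
  · rw [capOff_of_right hab ha hb hb', capOff_of_left _ _ (h a)] <;> grind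
  rw [capOff_of_ne ha hb ha' hb', capOff_of_ne ha' hb'] <;> grind

theorem capOff_ne (hab : a ≠ b) (hσ : Function.Involutive σ)
    (hne : ∀ p, σ p ≠ p) (p : α) : capOff a b σ p ≠ p := by
  have h := fun x => hσ x
  unfold capOff
  grind

/-- The noncrossing condition, for points placed on a line by `pos`. -/
def IsPlanar (pos : α → ℕ) (σ : α → α) : Prop :=
  ∀ u z, pos u < pos z → pos z < pos (σ u) → pos u < pos (σ z) ∧ pos (σ z) < pos (σ u)

/-- Since `a` and `b` are neighbours, no point sits between them. The new arc from `σ a` to `σ b`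
follows the two old arcs, so whatever crosses it would already cross one of these. -/
theorem capOff_isPlanar {pos : α → ℕ} (hpos : Function.Injective pos)
    (hab : pos b = pos a + 1) (hσ : Function.Involutive σ) (hne : ∀ p, σ p ≠ p)
    (hnc : IsPlanar pos σ) :
    IsPlanar pos (capOff a b σ) := by
  have hab' : a ≠ b := by rintro rfl; omega
  -- An arc avoiding `a` and `b` has them both on the same side.
  have across : ∀ u, u ≠ a → u ≠ b → σ u ≠ a → σ u ≠ b →
      (pos u < pos a ↔ pos u < pos b) ∧ (pos a < pos (σ u) ↔ pos b < pos (σ u)) := by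
    intro u h1 h2 h3 h4
    have := hpos.ne h1; have := hpos.ne h2; have := hpos.ne h3; have := hpos.ne h4
    omega
  -- An old arc away from `a` and `b` does not cross the arc joining their partners.
  have new : ∀ c d, (c = a ∧ d = b ∨ c = b ∧ d = a) → ∀ z, z ≠ a → z ≠ b → σ z ≠ a → σ z ≠ b →
      pos (σ c) < pos z → pos z < pos (σ d) → pos (σ c) < pos (σ z) ∧ pos (σ z) < pos (σ d) := by
    intro c d hcd z h1 h2 h3 h4 h5 h6
    have hzc : σ z ≠ σ c := fun h => by have := hσ.injective h; grind
    have hzd : σ z ≠ σ d := fun h => by have := hσ.injective h; grind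
    have := hpos.ne hzc; have := hpos.ne hzd
    have hz := hσ z
    have hc := hσ c
    have hd := hσ d
    have e1 := hnc z (σ d)
    have e2 := hnc z c
    have e3 := hnc (σ z) (σ c)
    have e4 := hnc (σ z) d
    have f := across z h1 h2 h3 h4
    have f' := across (σ z) h3 h4 (by rwa [hz]) (by rwa [hz])
    rw [hz] at e3 e4 f'
    rw [hd] at e1
    rw [hc] at e3
    rcases hcd with ⟨rfl, rfl⟩ | ⟨rfl, rfl⟩ <;> omega
  -- Planarity asks that the points under an arc be stable under the matching; this reduces
  -- stability under `capOff` to conditions on `σ`.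
  have cases : ∀ P : α → Prop, (P a ↔ P b) →
      (∀ z, z ≠ a → z ≠ b → P z → σ z = a → P (σ b)) →
      (∀ z, z ≠ a → z ≠ b → P z → σ z = b → P (σ a)) →
      (∀ z, z ≠ a → z ≠ b → σ z ≠ a → σ z ≠ b → P z → P (σ z)) →
      ∀ z, P z → P (capOff a b σ z) := by
    intro P h1 h2 h3 h4 z hz
    by_cases ha : z = a
    · rw [ha] at hz ⊢; rwa [capOff_left, ← h1]
    by_cases hb : z = b
    · rw [hb] at hz ⊢; rwa [capOff_right, h1]
    by_cases ha' : σ z = a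
    · rw [capOff_of_left ha hb ha']; exact h2 z ha hb hz ha'
    by_cases hb' : σ z = b
    · rw [capOff_of_right hab' ha hb hb']; exact h3 z ha hb hz hb'
    rw [capOff_of_ne ha hb ha' hb']; exact h4 z ha hb ha' hb' hz
  have joined : ∀ c d, (c = a ∧ d = b ∨ c = b ∧ d = a) → σ c ≠ d → ∀ z,
      pos (σ c) < pos z ∧ pos z < pos (σ d) →
      pos (σ c) < pos (capOff a b σ z) ∧ pos (capOff a b σ z) < pos (σ d) := by
    intro c d hcd hne'
    have hne'' : σ d ≠ c := fun h => hne' (by rw [← h, hσ d])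
    have e1 := hpos.ne hne'
    have e2 := hpos.ne hne''
    have e3 := hpos.ne (hne c)
    have e4 := hpos.ne (hne d)
    apply cases
    · rcases hcd with ⟨rfl, rfl⟩ | ⟨rfl, rfl⟩ <;> omega
    · intro z _ _ h h'
      have : z = σ a := by rw [← h', hσ z]
      rcases hcd with ⟨rfl, rfl⟩ | ⟨rfl, rfl⟩ <;> rw [this] at h <;> omega
    · intro z _ _ h h'
      have : z = σ b := by rw [← h', hσ z]
      rcases hcd with ⟨rfl, rfl⟩ | ⟨rfl, rfl⟩ <;> rw [this] at h <;> omega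
    · intro z h1 h2 h3 h4 h5
      exact new c d hcd z h1 h2 h3 h4 h5.1 h5.2
  intro u z h1 h2
  by_cases ua : u = a
  · rw [ua, capOff_left] at h2; rw [ua] at h1; omega
  by_cases ub : u = b
  · rw [ub, capOff_right] at h2; rw [ub] at h1; omega
  by_cases ua' : σ u = a
  · rw [capOff_of_left ua ub ua'] at h2 ⊢
    have hu : u = σ a := by rw [← ua', hσ u]
    rw [hu] at h1 ub ⊢
    exact joined a b (Or.inl ⟨rfl, rfl⟩) ub z ⟨h1, h2⟩
  by_cases ub' : σ u = b
  · rw [capOff_of_right hab' ua ub ub'] at h2 ⊢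
    have hu : u = σ b := by rw [← ub', hσ u]
    rw [hu] at h1 ua ⊢
    exact joined b a (Or.inr ⟨rfl, rfl⟩) ua z ⟨h1, h2⟩
  rw [capOff_of_ne ua ub ua' ub'] at h2 ⊢
  have e := across u ua ub ua' ub'
  refine cases (fun w => pos u < pos w ∧ pos w < pos (σ u)) (and_congr e.1 e.2) ?_ ?_ ?_ z ⟨h1, h2⟩
  · intro w _ _ hw hw'
    have h := hnc u w hw.1 hw.2
    rw [hw'] at h
    exact hnc u b (e.1.1 h.1) (e.2.1 h.2)
  · intro w _ _ hw hw'
    have h := hnc u w hw.1 hw.2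
    rw [hw'] at h
    exact hnc u a (e.1.2 h.1) (e.2.2 h.2)
  · exact fun w _ _ _ _ hw => hnc u w hw.1 hw.2

end CapOff

/-! ### The diagrams of words as matchings -/

section Diagrams

variable {n : ℕ}

/-- `D` is the perfect matching joining each point `p` to `σ p`. -/
structure IsMatching (D : Diagram n) (σ : Fin (n + 1) ⊕ Fin (n + 1) → Fin (n + 1) ⊕ Fin (n + 1)) :
    Prop where
  invol : Function.Involutive σ
  ne : ∀ p, σ p ≠ p
  adj_iff : ∀ p q, D.Adj p q ↔ σ p = q

theorem isMatching_idDiagram : IsMatching (idDiagram n) Sum.swap where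
  invol := Sum.swap_swap
  ne := by rintro (p | p) <;> simp
  adj_iff := by
    rintro (p | p) (q | q) <;> simp [idDiagram, SimpleGraph.fromRel_adj, eq_comm]

/-- Invariants of this kind show that points of a picture are not connected. -/
theorem reachable_label {V β : Type*} {G : SimpleGraph V} {c : V → β}
    (h : ∀ u v, G.Adj u v → c u = c v) {u v : V} (huv : G.Reachable u v) : c u = c v := by
  obtain ⟨w⟩ := huv
  induction w with
  | nil => rfl
  | cons e _ ih => exact (h _ _ e).trans ih

theorem stacked_reachable_top {D E : Diagram n} {p q : Fin (n + 1) ⊕ Fin (n + 1)}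
    (h : D.Adj p q) : (stacked D E).Reachable (place 0 1 p) (place 0 1 q) := by
  by_cases hpq : place 0 1 p = place 0 1 q
  · rw [hpq]
  · exact SimpleGraph.Adj.reachable
      ((SimpleGraph.fromRel_adj _ _ _).2 ⟨hpq, Or.inl (Or.inl ⟨p, q, h, rfl, rfl⟩)⟩)

theorem stacked_reachable_bot {D E : Diagram n} {p q : Fin (n + 1) ⊕ Fin (n + 1)}
    (h : E.Adj p q) : (stacked D E).Reachable (place 1 2 p) (place 1 2 q) := by
  by_cases hpq : place 1 2 p = place 1 2 q
  · rw [hpq]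
  · exact SimpleGraph.Adj.reachable
      ((SimpleGraph.fromRel_adj _ _ _).2 ⟨hpq, Or.inl (Or.inr ⟨p, q, h, rfl, rfl⟩)⟩)

theorem genDiagram_adj_inl (i : Fin n) :
    (genDiagram i).Adj (Sum.inl i.castSucc) (Sum.inl i.succ) := by
  simp [genDiagram, SimpleGraph.fromRel_adj, i.castSucc_lt_succ.ne]

theorem genDiagram_adj_inr (i : Fin n) :
    (genDiagram i).Adj (Sum.inr i.castSucc) (Sum.inr i.succ) := by
  simp [genDiagram, SimpleGraph.fromRel_adj, i.castSucc_lt_succ.ne]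

theorem genDiagram_adj_inl_inr (i : Fin n) {x : Fin (n + 1)} (h : x ≠ i.castSucc)
    (h' : x ≠ i.succ) : (genDiagram i).Adj (Sum.inl x) (Sum.inr x) := by
  simp [genDiagram, SimpleGraph.fromRel_adj, h, h']

/-- The path descends along a vertical line of `b_i`, follows an arc of `D`, crosses the lower arc
of `b_i` and a second arc of `D` if it meets `i` or `i + 1`, and leaves again. -/
theorem stacked_reachable_capOff {D : Diagram n}
    {σ : Fin (n + 1) ⊕ Fin (n + 1) → Fin (n + 1) ⊕ Fin (n + 1)} (hD : IsMatching D σ) (i : Fin n)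
    (p : Fin (n + 1) ⊕ Fin (n + 1)) :
    (stacked (genDiagram i) D).Reachable (place 0 2 p)
      (place 0 2 (capOff (Sum.inl i.castSucc) (Sum.inl i.succ) σ p)) := by
  have hab : (Sum.inl i.castSucc : Fin (n + 1) ⊕ Fin (n + 1)) ≠ Sum.inl i.succ := by
    simp [i.castSucc_lt_succ.ne]
  have hcap : (stacked (genDiagram i) D).Reachable (place 1 2 (Sum.inl i.castSucc))
      (place 1 2 (Sum.inl i.succ)) := stacked_reachable_top (genDiagram_adj_inr i)
  have hcup : (stacked (genDiagram i) D).Reachable (place 0 2 (Sum.inl i.castSucc))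
      (place 0 2 (Sum.inl i.succ)) := stacked_reachable_top (genDiagram_adj_inl i)
  have hσ : ∀ q, (stacked (genDiagram i) D).Reachable (place 1 2 q) (place 1 2 (σ q)) :=
    fun q => stacked_reachable_bot ((hD.adj_iff _ _).2 rfl)
  have hdown : ∀ q, q ≠ Sum.inl i.castSucc → q ≠ Sum.inl i.succ →
      (stacked (genDiagram i) D).Reachable (place 0 2 q) (place 1 2 q) := by
    rintro (x | x) h h'
    · exact stacked_reachable_top (genDiagram_adj_inl_inr i (by simpa using h) (by simpa using h'))
    · exact SimpleGraph.Reachable.refl _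
  generalize Sum.inl i.castSucc = a at *
  generalize Sum.inl i.succ = b at *
  have hinv := fun x => hD.invol x
  have hne := hD.ne
  by_cases ha : p = a
  · rw [ha, capOff_left]; exact hcup
  by_cases hb : p = b
  · rw [hb, capOff_right]; exact hcup.symm
  refine (hdown p ha hb).trans ((hσ p).trans ?_)
  by_cases ha' : σ p = a
  · rw [capOff_of_left ha hb ha', ha']
    exact hcap.trans ((hσ b).trans (hdown _ (by grind) (by grind)).symm)
  by_cases hb' : σ p = b
  · rw [capOff_of_right hab ha hb hb', hb']
    exact hcap.symm.trans ((hσ a).trans (hdown _ (by grind) (by grind)).symm)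
  rw [capOff_of_ne ha hb ha' hb']
  exact (hdown _ ha' hb').symm

/-- Labelling each point by a pair of outer points, constantly along edges, shows that components
contain no further outer points. -/
theorem eq_or_eq_capOff_of_reachable {D : Diagram n}
    {σ : Fin (n + 1) ⊕ Fin (n + 1) → Fin (n + 1) ⊕ Fin (n + 1)} (hD : IsMatching D σ) (i : Fin n)
    {p q : Fin (n + 1) ⊕ Fin (n + 1)}
    (h : (stacked (genDiagram i) D).Reachable (place 0 2 p) (place 0 2 q)) :
    q = p ∨ q = capOff (Sum.inl i.castSucc) (Sum.inl i.succ) σ p := by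
  have hab : (Sum.inl i.castSucc : Fin (n + 1) ⊕ Fin (n + 1)) ≠ Sum.inl i.succ := by
    simp [i.castSucc_lt_succ.ne]
  set a : Fin (n + 1) ⊕ Fin (n + 1) := Sum.inl i.castSucc with ha
  set b : Fin (n + 1) ⊕ Fin (n + 1) := Sum.inl i.succ with hb
  have hinv := fun x => hD.invol x
  have hne := hD.ne
  -- the label of a point of the picture: the pair of outer points it is connected to
  set L : Fin (n + 1) ⊕ Fin (n + 1) → Set (Fin (n + 1) ⊕ Fin (n + 1)) :=
    fun p => {p, capOff a b σ p} with hL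
  -- In the middle row `a` and `b` lie on the lower arc of `b_i`, so both receive the ends of the
  -- joined arc. If `σ a = b` they lie on a closed circle, whose label is immaterial.
  set c' : Fin (n + 1) ⊕ Fin (n + 1) → Set (Fin (n + 1) ⊕ Fin (n + 1)) :=
    fun p => if p = a ∨ p = b then {σ a, σ b} else L p with hc'
  set c : Fin 3 × Fin (n + 1) → Set (Fin (n + 1) ⊕ Fin (n + 1)) :=
    fun u => if u.1 = 0 then L (Sum.inl u.2) else if u.1 = 1 then c' (Sum.inl u.2)
      else L (Sum.inr u.2) with hc
  have hc0 : ∀ p, c (place 0 2 p) = L p := by rintro (x | x) <;> simp [hc, place]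
  have hc1 : ∀ p, c (place 1 2 p) = c' p := by
    rintro (x | x)
    · simp [hc, place]
    · simp [hc, hc', place, ha, hb]
  have hLab : L a = L b := by
    simp only [hL, capOff_left, capOff_right, Set.pair_comm]
  have hbot : ∀ p, c' p = c' (σ p) := by
    have key : ∀ p, p ≠ a → p ≠ b → c' p = c' (σ p) := by
      intro p h1 h2
      by_cases h3 : σ p = a
      · have : σ a = p := by rw [← h3, hinv]
        simp [hc', hL, h1, h2, h3, capOff_of_left h1 h2 h3, this]
      by_cases h4 : σ p = b
      · have : σ b = p := by rw [← h4, hinv]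
        simp [hc', hL, h1, h2, h4, capOff_of_right hab h1 h2 h4, this, Set.pair_comm]
      have h5 := capOff_of_ne h1 h2 h3 h4
      have h6 : capOff a b σ (σ p) = p := by rw [← h5, capOff_involutive hab hD.invol hne]
      simp only [hc', hL, h1, h2, h3, h4, or_self, if_false, h5, h6, Set.pair_comm]
    intro p
    by_cases hp : p = a ∨ p = b
    · by_cases hp' : σ p = a ∨ σ p = b
      · simp [hc', hp, hp']
      · rw [key (σ p) (by tauto) (by tauto), hinv]
    · exact key p (by tauto) (by tauto)
  have hgen : ∀ p q, (genDiagram i).Adj p q → c (place 0 1 p) = c (place 0 1 q) := by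
    have key : ∀ p q, ((p = Sum.inl i.castSucc ∧ q = Sum.inl i.succ) ∨
        (p = Sum.inr i.castSucc ∧ q = Sum.inr i.succ) ∨
        ∃ x, x ≠ i.castSucc ∧ x ≠ i.succ ∧ p = Sum.inl x ∧ q = Sum.inr x) →
        c (place 0 1 p) = c (place 0 1 q) := by
      rintro p q (⟨rfl, rfl⟩ | ⟨rfl, rfl⟩ | ⟨x, h1, h2, rfl, rfl⟩)
      · simpa [hc, place] using hLab
      · simp [hc, place, hc', ha, hb]
      · simp [hc, place, hc', ha, hb, h1, h2]
    intro p q hpq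
    rcases ((SimpleGraph.fromRel_adj _ _ _).1 hpq).2 with h | h
    · exact key _ _ h
    · exact (key _ _ h).symm
  have hc2 : c (place 0 2 p) = c (place 0 2 q) := by
    refine reachable_label ?_ h
    have key : ∀ u v, ((∃ p q, (genDiagram i).Adj p q ∧ u = place 0 1 p ∧ v = place 0 1 q) ∨
        (∃ p q, D.Adj p q ∧ u = place 1 2 p ∧ v = place 1 2 q)) → c u = c v := by
      rintro u v (⟨p, q, hpq, rfl, rfl⟩ | ⟨p, q, hpq, rfl, rfl⟩)
      · exact hgen p q hpq
      · rw [hc1, hc1, ← (hD.adj_iff _ _).1 hpq, hbot]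
    intro u v huv
    rcases ((SimpleGraph.fromRel_adj _ _ _).1 huv).2 with h | h
    · exact key _ _ h
    · exact (key _ _ h).symm
  rw [hc0, hc0] at hc2
  have : q ∈ L p := by rw [hc2]; exact Set.mem_insert _ _
  exact this

theorem IsMatching.concat_genDiagram {D : Diagram n}
    {σ : Fin (n + 1) ⊕ Fin (n + 1) → Fin (n + 1) ⊕ Fin (n + 1)} (hD : IsMatching D σ)
    (i : Fin n) :
    IsMatching (concat (genDiagram i) D) (capOff (Sum.inl i.castSucc) (Sum.inl i.succ) σ) := by
  have hab : (Sum.inl i.castSucc : Fin (n + 1) ⊕ Fin (n + 1)) ≠ Sum.inl i.succ := by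
    simp [i.castSucc_lt_succ.ne]
  refine ⟨capOff_involutive hab hD.invol hD.ne, capOff_ne hab hD.invol hD.ne, fun p q => ?_⟩
  constructor
  · rintro ⟨hpq, h⟩
    exact ((eq_or_eq_capOff_of_reachable hD i h).resolve_left hpq.symm).symm
  · rintro rfl
    exact ⟨(capOff_ne hab hD.invol hD.ne p).symm, stacked_reachable_capOff hD i p⟩

/-- The position of a point of a diagram on its boundary: top points from left to right, then
bottom points from right to left. -/
def boundaryPos (n : ℕ) : Fin (n + 1) ⊕ Fin (n + 1) → ℕ :=
  Sum.elim (fun x => x) (fun x => 2 * n + 1 - x)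

theorem boundaryPos_injective : Function.Injective (boundaryPos n) := by
  rintro (x | x) (y | y) h <;> simp only [boundaryPos, Sum.elim_inl, Sum.elim_inr] at h <;>
    have := x.isLt <;> have := y.isLt
  · exact congrArg _ (Fin.ext h)
  · omega
  · omega
  · exact congrArg _ (Fin.ext (by omega))

/-- The matching of the diagram of a word. -/
def wordMatching : List (Fin n) → Fin (n + 1) ⊕ Fin (n + 1) → Fin (n + 1) ⊕ Fin (n + 1)
  | [] => Sum.swap
  | i :: l => capOff (Sum.inl i.castSucc) (Sum.inl i.succ) (wordMatching l)

theorem isMatching_wordDiagram (l : List (Fin n)) : IsMatching (wordDiagram l) (wordMatching l) := by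
  induction l with
  | nil => exact isMatching_idDiagram
  | cons i l ih => exact ih.concat_genDiagram i

theorem isPlanar_wordMatching (l : List (Fin n)) : IsPlanar (boundaryPos n) (wordMatching l) := by
  induction l with
  | nil =>
    rintro (x | x) (y | y) h1 h2 <;>
      simp only [boundaryPos, wordMatching, Sum.swap_inl, Sum.swap_inr, Sum.elim_inl,
        Sum.elim_inr] at h1 h2 ⊢ <;>
      omega
  | cons i l ih =>
    exact capOff_isPlanar boundaryPos_injective (by simp [boundaryPos])
      (isMatching_wordDiagram l).invol (isMatching_wordDiagram l).ne ih

/-- In the boundary order every bottom point comes after all top points, so a line to the bottom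
cannot start under a cup. -/
theorem planar_cups (l : List (Fin n)) {a b x : Fin (n + 1)}
    (hab : (wordDiagram l).Adj (Sum.inl a) (Sum.inl b)) (hax : a < x) (hxb : x < b) :
    ∃ y, (wordDiagram l).Adj (Sum.inl x) (Sum.inl y) ∧ a < y ∧ y < b := by
  have hM := isMatching_wordDiagram l
  rw [hM.adj_iff] at hab
  have h := isPlanar_wordMatching l (Sum.inl a) (Sum.inl x) hax (by rw [hab]; exact hxb)
  rw [hab] at h
  rcases hy : wordMatching l (Sum.inl x) with y | y
  · rw [hy] at h
    exact ⟨y, (hM.adj_iff _ _).2 hy, h.1, h.2⟩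
  · rw [hy] at h
    have := y.isLt
    have := b.isLt
    simp only [boundaryPos, Sum.elim_inl, Sum.elim_inr] at h
    omega

end Diagrams

/-! ### Partial matchings and sets of commuting reflections -/

section Cups

variable {n : ℕ}

/-- A partial matching of the letters. -/
structure IsPartialMatching (C : Fin (n + 1) → Fin (n + 1) → Prop) : Prop where
  symm : ∀ x y, C x y → C y x
  irrefl : ∀ x, ¬ C x x
  unique : ∀ x y z, C x y → C x z → y = z

/-- The reflections attached to the pairs of a relation. -/
def reflSet (C : Fin (n + 1) → Fin (n + 1) → Prop) : Set (Equiv.Perm (Fin (n + 1))) :=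
  {t | ∃ x y, C x y ∧ t = Equiv.swap x y}

theorem swap_eq_swap {x y x' y' : Fin (n + 1)} (hxy : x ≠ y)
    (h : Equiv.swap x y = Equiv.swap x' y') : (x = x' ∧ y = y') ∨ (x = y' ∧ y = x') := by
  have h1 : Equiv.swap x' y' x = y := by rw [← h, Equiv.swap_apply_left]
  rw [Equiv.swap_apply_def] at h1
  split_ifs at h1 <;> grind

variable {C : Fin (n + 1) → Fin (n + 1) → Prop}

theorem IsPartialMatching.swap_mem_reflSet (hC : IsPartialMatching C) {x y : Fin (n + 1)}
    (hxy : x ≠ y) : Equiv.swap x y ∈ reflSet C ↔ C x y := by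
  constructor
  · rintro ⟨x', y', h, e⟩
    rcases swap_eq_swap hxy e with ⟨rfl, rfl⟩ | ⟨rfl, rfl⟩
    · exact h
    · exact hC.symm _ _ h
  · exact fun h => ⟨x, y, h, rfl⟩

theorem IsPartialMatching.isCommutingReflSet (hC : IsPartialMatching C) :
    IsCommutingReflSet (reflSet C) := by
  have hne : ∀ x y, C x y → x ≠ y := fun x y h e => hC.irrefl x (by rwa [← e] at h)
  constructor
  · rintro t ⟨x, y, h, rfl⟩
    exact ⟨x, y, hne x y h, rfl⟩
  · rintro t ⟨x, y, h, rfl⟩ t' ⟨x', y', h', rfl⟩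
    have hs := hC.symm
    have hu := hC.unique
    by_cases e1 : x = x'
    · subst e1; rw [hu _ _ _ h h']
    by_cases e2 : x = y'
    · subst e2; rw [hu _ _ _ h (hs _ _ h'), Equiv.swap_comm]
    have e3 : y ≠ x' := by rintro rfl; exact e2 (hu _ _ _ (hs _ _ h) h')
    have e4 : y ≠ y' := by rintro rfl; exact e1 (hu _ _ _ (hs _ _ h) (hs _ _ h'))
    refine (Equiv.Perm.disjoint_iff_eq_or_eq.2 fun z => ?_).commute
    by_cases hz : z = x ∨ z = y
    · right; exact Equiv.swap_apply_of_ne_of_ne (by grind) (by grind)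
    · left; exact Equiv.swap_apply_of_ne_of_ne (by grind) (by grind)

theorem IsPartialMatching.mem_suppSet (hC : IsPartialMatching C) {x : Fin (n + 1)} :
    x ∈ suppSet (reflSet C) ↔ ∃ y, C x y := by
  constructor
  · rintro ⟨t, ⟨a, b, h, rfl⟩, hx⟩
    rcases Equiv.swap_apply_ne_self_iff.1 hx with ⟨-, rfl | rfl⟩
    · exact ⟨_, h⟩
    · exact ⟨_, hC.symm _ _ h⟩
  · rintro ⟨y, h⟩
    refine ⟨_, ⟨x, y, h, rfl⟩, ?_⟩
    rw [Equiv.swap_apply_left]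
    rintro rfl
    exact hC.irrefl _ h

/-- A nonempty partial matching such that each point below an arc is joined to a point below
this arc gives a dense set of reflections. -/
theorem IsPartialMatching.isDenseReflSet (hC : IsPartialMatching C)
    (hnc : ∀ a b x, C a b → a < x → x < b → ∃ y, C x y ∧ a < y ∧ y < b)
    (hne : ∃ x y, C x y) : IsDenseReflSet (reflSet C) := by
  classical
  have hs := hC.symm
  have hu := hC.unique
  refine ⟨hC.isCommutingReflSet, ?_, ?_⟩
  · rintro i k j l hik hkj hjl ⟨h1, h2⟩
    rw [hC.swap_mem_reflSet (hik.trans hkj).ne] at h1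
    rw [hC.swap_mem_reflSet (hkj.trans hjl).ne] at h2
    obtain ⟨y, h3, -, h4⟩ := hnc i j k h1 hik hkj
    rw [hu _ _ _ h3 h2] at h4
    exact absurd (h4.trans hjl) (lt_irrefl _)
  -- The left ends of the outermost arcs; listed in increasing order they are the `m_q`.
  set O : Finset (Fin (n + 1)) := Finset.univ.filter fun x =>
    (∃ y, C x y ∧ x < y) ∧ ∀ a b, C a b → ¬ (a < x ∧ x < b) with hO
  have hmem : ∀ x, x ∈ O ↔ (∃ y, C x y ∧ x < y) ∧ ∀ a b, C a b → ¬ (a < x ∧ x < b) := by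
    intro x; simp [hO]
  set m : Fin O.card → Fin (n + 1) := fun q => O.orderEmbOfFin rfl q with hm
  have hmO : ∀ q, m q ∈ O := fun q => O.orderEmbOfFin_mem rfl q
  choose j hj using fun q => ((hmem _).1 (hmO q)).1
  have hout := fun q => ((hmem _).1 (hmO q)).2
  have hcov : ∀ x y, C x y → ∃ q, m q ≤ x ∧ x ≤ j q := by
    intro x y hxy
    -- Left ends of the arcs covering `x`; the smallest belongs to an outermost arc.
    set S : Finset (Fin (n + 1)) := Finset.univ.filter fun a => ∃ b, C a b ∧ a < b ∧ a ≤ x ∧ x ≤ b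
    have hS : S.Nonempty := by
      rcases lt_trichotomy x y with h | h | h
      · exact ⟨x, by simpa [S] using ⟨y, hxy, h, h.le⟩⟩
      · exact absurd (h ▸ hxy) (hC.irrefl _)
      · exact ⟨y, by simpa [S] using ⟨x, hs _ _ hxy, h, h.le, le_rfl⟩⟩
    obtain ⟨b, hb, hlt, hax, hxb⟩ : ∃ b, C (S.min' hS) b ∧ S.min' hS < b ∧ S.min' hS ≤ x ∧ x ≤ b := by
      have := S.min'_mem hS
      simpa [S] using this
    have hmin : ∀ a b, C a b → a < b → a ≤ x → x ≤ b → S.min' hS ≤ a := fun a b h1 h2 h3 h4 =>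
      S.min'_le a (by simpa [S] using ⟨b, h1, h2, h3, h4⟩)
    have haO : S.min' hS ∈ O := by
      refine (hmem _).2 ⟨⟨b, hb, hlt⟩, ?_⟩
      rintro a' b' h ⟨h1, h2⟩
      obtain ⟨y', h3, -, h4⟩ := hnc a' b' _ h h1 h2
      rw [← hu _ _ _ hb h3] at h4
      exact absurd (hmin a' b' h (h1.trans h2) (h1.le.trans hax) (hxb.trans h4.le)) (not_le.2 h1)
    obtain ⟨q, hq⟩ : S.min' hS ∈ Set.range m := by
      exact (Finset.range_orderEmbOfFin O rfl).symm ▸ haO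
    refine ⟨q, hq ▸ hax, ?_⟩
    have : j q = b := hu _ _ _ (hj q).1 (hq ▸ hb)
    rwa [this]
  refine ⟨O.card, m, j, ?_, fun q => (hj q).2, ?_, fun q => ⟨_, _, (hj q).1, rfl⟩, ?_⟩
  · obtain ⟨x, y, h⟩ := hne
    obtain ⟨q, -⟩ := hcov x y h
    exact q.pos
  · intro q q' hqq
    have h1 : m q < m q' := (O.orderEmbOfFin rfl).strictMono hqq
    rcases lt_trichotomy (j q) (m q') with h | h | h
    · exact h
    · have h2 := hu _ _ _ (hs _ _ (hj q).1) (h ▸ (hj q').1)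
      have h3 := (hj q').2
      rw [← h2] at h3
      exact absurd (h3.trans h1) (lt_irrefl _)
    · exact absurd ⟨h1, h⟩ (hout q' _ _ (hj q).1)
  · ext x
    rw [hC.mem_suppSet, Set.mem_iUnion]
    constructor
    · rintro ⟨y, h⟩
      exact hcov x y h
    · rintro ⟨q, h1, h2⟩
      rcases h1.eq_or_lt with h1 | h1
      · exact ⟨_, h1 ▸ (hj q).1⟩
      rcases h2.eq_or_lt with h2 | h2
      · exact ⟨_, h2 ▸ hs _ _ (hj q).1⟩
      obtain ⟨y, h, -⟩ := hnc _ _ x (hj q).1 h1 h2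
      exact ⟨y, h⟩

/-- Two letters that are not matched get the same colour in some colouring, with both colours
used, in which matched letters have different colours. -/
theorem IsPartialMatching.exists_colouring (hC : IsPartialMatching C)
    (h1 : n = 1 → ∃ x y, C x y) {x y : Fin (n + 1)} (hxy : x ≠ y) (h : ¬ C x y) :
    ∃ p : Fin (n + 1) → Prop, (p x ↔ p y) ∧ (∀ a b, C a b → ¬ (p a ↔ p b)) ∧
      ∃ a b, p a ∧ ¬ p b := by
  have hs := hC.symm
  have hi := hC.irrefl
  have hu := hC.unique
  -- The letters `x` and `y` get the first colour and their partners the second, which is consistent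
  -- as `x` and `y` are not matched. On every other arc the left end gets the first colour;
  -- remaining unmatched letters get the second.
  set p : Fin (n + 1) → Prop := fun z => z = x ∨ z = y ∨
    (¬ C z x ∧ ¬ C z y ∧ ∃ w, C z w ∧ z < w) with hp
  have hpx : p x := Or.inl rfl
  have hpy : p y := Or.inr (Or.inl rfl)
  have hpC : ∀ a b, C a b → a < b → a ≠ x → a ≠ y → b ≠ x → b ≠ y → p a ∧ ¬ p b := by
    intro a b hab hlt ax ay bx by'
    refine ⟨Or.inr (Or.inr ⟨fun h => bx (hu _ _ _ hab h), fun h => by' (hu _ _ _ hab h),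
      b, hab, hlt⟩), ?_⟩
    rintro (h | h | ⟨-, -, w, hw, hlt'⟩)
    · exact bx h
    · exact by' h
    · rw [hu _ _ _ hw (hs _ _ hab)] at hlt'
      exact lt_asymm hlt hlt'
  have hnx : ∀ b, C x b → ¬ p b := by
    rintro b hb (rfl | rfl | ⟨h, -⟩)
    · exact hi _ hb
    · exact h hb
    · exact h (hs _ _ hb)
  have hny : ∀ b, C y b → ¬ p b := by
    rintro b hb (rfl | rfl | ⟨-, h, -⟩)
    · exact h (hs _ _ hb)
    · exact hi _ hb
    · exact h (hs _ _ hb)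
  refine ⟨p, iff_of_true hpx hpy, ?_, ?_⟩
  · intro a b hab
    by_cases ax : a = x
    · subst ax; exact fun e => hnx b hab (e.1 hpx)
    by_cases ay : a = y
    · subst ay; exact fun e => hny b hab (e.1 hpy)
    by_cases bx : b = x
    · subst bx; exact fun e => hnx a (hs _ _ hab) (e.2 hpx)
    by_cases by' : b = y
    · subst by'; exact fun e => hny a (hs _ _ hab) (e.2 hpy)
    rcases lt_trichotomy a b with hlt | rfl | hlt
    · have h2 := hpC a b hab hlt ax ay bx by'
      exact fun e => h2.2 (e.1 h2.1)
    · exact absurd hab (hi _)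
    · have h2 := hpC b a (hs _ _ hab) hlt bx by' ax ay
      exact fun e => h2.2 (e.2 h2.1)
  · by_cases hx : ∃ b, C x b
    · obtain ⟨b, hb⟩ := hx
      exact ⟨x, b, hpx, hnx b hb⟩
    by_cases hy : ∃ b, C y b
    · obtain ⟨b, hb⟩ := hy
      exact ⟨y, b, hpy, hny b hb⟩
    push Not at hx hy
    by_cases hne : ∃ a b, C a b
    · obtain ⟨a, b, hab⟩ := hne
      have ax : a ≠ x := fun e => hx b (e ▸ hab)
      have ay : a ≠ y := fun e => hy b (e ▸ hab)
      have bx : b ≠ x := fun e => hx a (e ▸ hs _ _ hab)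
      have by' : b ≠ y := fun e => hy a (e ▸ hs _ _ hab)
      rcases lt_trichotomy a b with hlt | rfl | hlt
      · exact ⟨a, b, hpC a b hab hlt ax ay bx by'⟩
      · exact absurd hab (hi _)
      · exact ⟨b, a, hpC b a (hs _ _ hab) hlt bx by' ax ay⟩
    -- Without arcs a third letter is needed to use the second colour; it exists since `n ≠ 1`.
    · have hn : n ≠ 1 := fun e => hne (h1 e)
      obtain ⟨z, hz⟩ : ∃ z, z ∉ ({x, y} : Finset (Fin (n + 1))) := by
        by_contra! hall
        have h2 : (Finset.univ : Finset (Fin (n + 1))).card ≤ 2 :=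
          (Finset.card_le_card fun z _ => hall z).trans Finset.card_le_two
        have h3 : x.val ≠ y.val := fun e => hxy (Fin.ext e)
        have := x.isLt
        have := y.isLt
        rw [Finset.card_univ, Fintype.card_fin] at h2
        omega
      refine ⟨x, z, hpx, ?_⟩
      rintro (h | h | ⟨-, -, w, hw, -⟩)
      · exact hz (by simp [h])
      · exact hz (by simp [h])
      · exact hne ⟨z, w, hw⟩

/-- The pairs of letters exchanged by the elements of a set of commuting reflections form a
partial matching. -/
theorem IsCommutingReflSet.isPartialMatching {T : Set (Equiv.Perm (Fin (n + 1)))}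
    (hT : IsCommutingReflSet T) :
    IsPartialMatching fun x y => x ≠ y ∧ Equiv.swap x y ∈ T where
  symm x y h := ⟨h.1.symm, Equiv.swap_comm x y ▸ h.2⟩
  irrefl x h := h.1 rfl
  unique x y z h h' := by
    by_contra hyz
    -- The two products send `x` to `z` and to `y` respectively.
    have h1 := DFunLike.congr_fun (hT.2 _ h.2 _ h'.2).eq x
    rw [Equiv.Perm.mul_apply, Equiv.Perm.mul_apply, Equiv.swap_apply_left, Equiv.swap_apply_left,
      Equiv.swap_apply_of_ne_of_ne h'.1.symm (Ne.symm hyz),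
      Equiv.swap_apply_of_ne_of_ne h.1.symm hyz] at h1
    exact hyz h1.symm

theorem IsCommutingReflSet.eq_reflSet {T : Set (Equiv.Perm (Fin (n + 1)))}
    (hT : IsCommutingReflSet T) : T = reflSet fun x y => x ≠ y ∧ Equiv.swap x y ∈ T := by
  ext t
  constructor
  · intro ht
    obtain ⟨x, y, hxy, rfl⟩ := hT.1 t ht
    exact ⟨x, y, ⟨hxy, ht⟩, rfl⟩
  · rintro ⟨x, y, ⟨-, h⟩, rfl⟩
    exact h

end Cups

/-! ### Weyl lines as two-valued vectors -/

section TwoValued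

variable {k : Type*} [Field k] {n : ℕ}

theorem mem_geomRep {v : Fin (n + 1) → k} : v ∈ geomRep k n ↔ ∑ x, v x = 0 := Iff.rfl

theorem mem_reflHyperplane_swap {x y : Fin (n + 1)} {v : Fin (n + 1) → k} :
    v ∈ reflHyperplane k (Equiv.swap x y) ↔ ∑ z, v z = 0 ∧ v x = v y := by
  rw [reflHyperplane, Submodule.mem_inf, mem_geomRep, LinearMap.mem_eqLocus]
  refine and_congr_right fun _ => ⟨fun h => ?_, fun h => ?_⟩
  · have := congrFun h y
    simpa [permAct, LinearMap.funLeft_apply] using this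
  · funext z
    simp only [permAct, LinearMap.funLeft_apply, Equiv.swap_inv, LinearMap.id_apply]
    rw [Equiv.swap_apply_def]
    split_ifs with h1 h2 <;> simp_all

theorem IsWeylLine.eq_span {L : Submodule k (Fin (n + 1) → k)} (hL : IsWeylLine k L)
    {v : Fin (n + 1) → k} (hv : v ∈ L) (h0 : v ≠ 0) : L = Submodule.span k {v} := by
  have : FiniteDimensional k L := FiniteDimensional.of_finrank_pos (by rw [hL.1]; exact one_pos)
  refine (Submodule.eq_of_le_of_finrank_eq ?_ ?_).symm
  · rwa [Submodule.span_singleton_le_iff_mem]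
  · rw [finrank_span_singleton h0, hL.1]

/-- A vector with coordinate sum zero taking at most two values. -/
def IsTwoValued (v : Fin (n + 1) → k) : Prop :=
  ∑ x, v x = 0 ∧ ∀ x y z, v x = v y ∨ v y = v z ∨ v x = v z

variable [CharZero k]

/-- Squaring coordinates preserves the equations `v x = v y`. After subtracting the mean, the
squared vector lies on the same line, so it is a multiple of `v`, and all coordinates of `v` are
roots of one quadratic polynomial. -/
theorem IsWeylLine.isTwoValued {L : Submodule k (Fin (n + 1) → k)} (hL : IsWeylLine k L)
    {v : Fin (n + 1) → k} (hv : v ∈ L) : IsTwoValued v := by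
  obtain ⟨S, hS, hLS⟩ := hL.2
  by_cases h0 : v = 0
  · subst h0; exact ⟨by simp, by simp⟩
  have hn : ((n : k) + 1) ≠ 0 := by exact_mod_cast n.succ_ne_zero
  have hv' := hLS ▸ hv
  rw [Submodule.mem_inf, mem_geomRep] at hv'
  refine ⟨hv'.1, ?_⟩
  set c : k := (∑ x, v x ^ 2) / (n + 1) with hc
  have hw : (fun x => v x ^ 2 - c) ∈ L := by
    have hs : ∑ x, (v x ^ 2 - c) = 0 := by
      rw [Finset.sum_sub_distrib, Finset.sum_const, Finset.card_univ, Fintype.card_fin,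
        nsmul_eq_mul, hc]
      push_cast
      field_simp
      ring
    rw [hLS, Submodule.mem_inf, mem_geomRep]
    refine ⟨hs, ?_⟩
    simp only [Submodule.mem_iInf]
    intro t ht
    obtain ⟨x, y, -, rfl⟩ := hS t ht
    have h2 := hv'.2
    simp only [Submodule.mem_iInf] at h2
    have := h2 _ ht
    rw [mem_reflHyperplane_swap] at this ⊢
    exact ⟨hs, by rw [this.2]⟩
  rw [hL.eq_span hv h0, Submodule.mem_span_singleton] at hw
  obtain ⟨r, hr⟩ := hw
  have hq : ∀ x, r * v x = v x ^ 2 - c := fun x => congrFun hr x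
  intro x y z
  by_contra! h
  have e1 : (v x - v y) * (v x + v y - r) = 0 := by linear_combination hq y - hq x
  have e2 : (v y - v z) * (v y + v z - r) = 0 := by linear_combination hq z - hq y
  have e1 := (mul_eq_zero.1 e1).resolve_left (sub_ne_zero.2 h.1)
  have e2 := (mul_eq_zero.1 e2).resolve_left (sub_ne_zero.2 h.2.1)
  exact h.2.2 (by linear_combination e1 - e2)

/-- A nonzero vector with coordinate sum zero is not constant. -/
theorem exists_ne_of_sum_eq_zero {v : Fin (n + 1) → k} (hs : ∑ x, v x = 0) (h0 : v ≠ 0)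
    (x : Fin (n + 1)) : ∃ y, v y ≠ v x := by
  by_contra! h
  have hn : ((n : k) + 1) ≠ 0 := by exact_mod_cast n.succ_ne_zero
  have : ((n : k) + 1) * v x = 0 := by simpa [h] using hs
  have := (mul_eq_zero.1 this).resolve_left hn
  exact h0 (funext fun y => by rw [h y, this]; rfl)

/-- The line is cut out by all equalities between coordinates of `v`. A solution `u` is a function
of the two values of `v`, hence affine in `v`, and the zero sums kill the constant term. -/
theorem IsTwoValued.isWeylLine_span {v : Fin (n + 1) → k} (hv : IsTwoValued v) (h0 : v ≠ 0) :
    IsWeylLine k (Submodule.span k {v}) := by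
  refine ⟨finrank_span_singleton h0,
    {t | ∃ x y, x ≠ y ∧ v x = v y ∧ t = Equiv.swap x y}, ?_, ?_⟩
  · rintro t ⟨x, y, hxy, -, rfl⟩
    exact ⟨x, y, hxy, rfl⟩
  refine le_antisymm ?_ fun u hu => ?_
  · rw [Submodule.span_singleton_le_iff_mem, Submodule.mem_inf]
    simp only [Submodule.mem_iInf]
    refine ⟨hv.1, ?_⟩
    rintro t ⟨x, y, -, hxy, rfl⟩
    exact mem_reflHyperplane_swap.2 ⟨hv.1, hxy⟩
  · rw [Submodule.mem_inf, mem_geomRep] at hu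
    simp only [Submodule.mem_iInf] at hu
    have hu' : ∀ x y, v x = v y → u x = u y := by
      intro x y hxy
      by_cases h : x = y
      · rw [h]
      · exact (mem_reflHyperplane_swap.1 (hu.2 _ ⟨x, y, h, hxy, rfl⟩)).2
    obtain ⟨y, hy⟩ := exists_ne_of_sum_eq_zero hv.1 h0 0
    have hd : v y - v 0 ≠ 0 := sub_ne_zero.2 hy
    set r := (u y - u 0) / (v y - v 0) with hr
    have hr' : r * (v y - v 0) = u y - u 0 := div_mul_cancel₀ _ hd
    have key : ∀ x, u x = r * v x + (u 0 - r * v 0) := by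
      intro x
      rcases hv.2 x y 0 with h | h | h
      · rw [hu' x y h, h]; linear_combination -hr'
      · exact absurd h hy
      · rw [hu' x 0 h, h]; ring
    have hn : ((n : k) + 1) ≠ 0 := by exact_mod_cast n.succ_ne_zero
    have hsum : ((n : k) + 1) * (u 0 - r * v 0) = 0 := by
      have h := hu.1
      rw [Finset.sum_congr rfl fun x _ => key x, Finset.sum_add_distrib, ← Finset.mul_sum,
        hv.1] at h
      rw [Finset.sum_const, Finset.card_univ, Fintype.card_fin, nsmul_eq_mul] at h
      push_cast at h
      linear_combination h
    have hz := (mul_eq_zero.1 hsum).resolve_left hn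
    refine Submodule.mem_span_singleton.2 ⟨r, funext fun x => ?_⟩
    rw [key x, hz, add_zero]; rfl

/-- Any colouring of the letters by two colours, both used, is realized by a vector of a
Weyl line. -/
theorem exists_isTwoValued (p : Fin (n + 1) → Prop) {a b : Fin (n + 1)} (ha : p a) (hb : ¬ p b) :
    ∃ v : Fin (n + 1) → k, IsTwoValued v ∧ v ≠ 0 ∧ ∀ x y, v x = v y ↔ (p x ↔ p y) := by
  classical
  have hn : ((n : k) + 1) ≠ 0 := by exact_mod_cast n.succ_ne_zero
  set c : k := (∑ x, if p x then 1 else 0) / (n + 1) with hc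
  have hval : ∀ x y, ((if p x then (1 : k) else 0) - c = (if p y then (1 : k) else 0) - c) ↔
      (p x ↔ p y) := by
    intro x y
    rw [sub_left_inj]
    by_cases hx : p x <;> by_cases hy : p y <;> simp [hx, hy]
  refine ⟨fun x => (if p x then 1 else 0) - c, ⟨?_, ?_⟩, ?_, hval⟩
  · rw [Finset.sum_sub_distrib, Finset.sum_const, Finset.card_univ, Fintype.card_fin,
      nsmul_eq_mul, hc]
    push_cast
    field_simp
    ring
  · intro x y z
    simp only [hval]
    tauto
  · intro h
    have h1 := (hval a b).1 ((congrFun h a).trans (congrFun h b).symm)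
    exact hb (h1.1 ha)

theorem mem_transverseUnion_swap {x y : Fin (n + 1)} (hxy : x ≠ y) {v : Fin (n + 1) → k} :
    v ∈ transverseUnion k (Equiv.swap x y) ↔ IsTwoValued v ∧ (v = 0 ∨ v x ≠ v y) := by
  constructor
  · rintro ⟨L, hL, hLt, hv⟩
    refine ⟨hL.isTwoValued hv, ?_⟩
    by_contra! h
    refine hLt ?_
    rw [hL.eq_span hv h.1, Submodule.span_singleton_le_iff_mem, mem_reflHyperplane_swap]
    exact ⟨(hL.isTwoValued hv).1, h.2⟩
  · rintro ⟨hv, h⟩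
    by_cases h0 : v = 0
    -- Zero lies on every line, so some line transverse to the swap is needed: the colouring
    -- isolating `x` gives one.
    · obtain ⟨u, hu, hu0, hux⟩ := exists_isTwoValued (k := k) (fun z => z = x) rfl hxy.symm
      refine ⟨_, hu.isWeylLine_span hu0, ?_, h0 ▸ Submodule.zero_mem _⟩
      rw [Submodule.span_singleton_le_iff_mem, mem_reflHyperplane_swap]
      rintro ⟨-, h⟩
      exact hxy (((hux x y).1 h).1 rfl).symm
    · refine ⟨_, hv.isWeylLine_span h0, ?_, Submodule.mem_span_singleton_self v⟩
      rw [Submodule.span_singleton_le_iff_mem, mem_reflHyperplane_swap]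
      exact fun h' => (h.resolve_left h0) h'.2

/-- For `n = 0` there is no Weyl line, so `Z` would not even contain `0`. -/
theorem mem_weylUnion (hn : 0 < n) {v : Fin (n + 1) → k} :
    v ∈ weylUnion k n ↔ IsTwoValued v := by
  constructor
  · rintro ⟨L, hL, hv⟩
    exact hL.isTwoValued hv
  · intro hv
    by_cases h0 : v = 0
    · have h01 : (0 : Fin (n + 1)) ≠ Fin.last n := by
        rw [Ne, Fin.ext_iff]; simp; omega
      obtain ⟨L, hL, -, h⟩ := (mem_transverseUnion_swap h01).2 ⟨hv, Or.inl h0⟩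
      exact ⟨L, hL, h⟩
    · exact ⟨_, hv.isWeylLine_span h0, Submodule.mem_span_singleton_self v⟩

end TwoValued

/-! ### The varieties of words -/

section WordVariety

variable {k : Type*} [Field k] {n : ℕ}

theorem transverseUnion_subset (t : Equiv.Perm (Fin (n + 1))) :
    transverseUnion k t ⊆ weylUnion k n :=
  fun _ ⟨L, hL, _, hv⟩ => ⟨L, hL, hv⟩

theorem mem_permAct_image_simpleRefl (i : Fin n) {W : Set (Fin (n + 1) → k)}
    {v : Fin (n + 1) → k} :
    v ∈ permAct k (simpleRefl i) '' W ↔ (fun x => v (simpleRefl i x)) ∈ W := by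
  have hs : ∀ x, simpleRefl i (simpleRefl i x) = x := Equiv.swap_apply_self _ _
  have hinv : (simpleRefl i)⁻¹ = simpleRefl i := Equiv.swap_inv _ _
  constructor
  · rintro ⟨u, hu, rfl⟩
    simpa [permAct, LinearMap.funLeft_apply, hinv, hs] using hu
  · intro h
    refine ⟨_, h, funext fun x => ?_⟩
    simp [permAct, LinearMap.funLeft_apply, hinv, hs]

/-- With the value `Z` at the empty word, the recursion also covers words of one letter, because
`V_t ⊆ Z`. -/
theorem mem_wordVariety_cons (i : Fin n) (l : List (Fin n)) {v : Fin (n + 1) → k} :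
    v ∈ wordVariety k (i :: l) ↔ v ∈ transverseUnion k (simpleRefl i) ∧
      (v ∈ wordVariety k l ∨ (fun x => v (simpleRefl i x)) ∈ wordVariety k l) := by
  cases l with
  | nil => exact ⟨fun h => ⟨h, Or.inl (transverseUnion_subset _ h)⟩, fun h => h.1⟩
  | cons j l =>
    rw [← mem_permAct_image_simpleRefl]
    rfl

/-- Two-colourings adapted to the diagram of `b_i b`, in terms of the matching of `b`. -/
theorem colouring_capOff {β : Type*} {σ : Fin (n + 1) ⊕ Fin (n + 1) → Fin (n + 1) ⊕ Fin (n + 1)}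
    (hσ : Function.Involutive σ) (hne : ∀ p, σ p ≠ p) {a b : Fin (n + 1)} (hab : a ≠ b)
    {v : Fin (n + 1) → β} (hv : ∀ x y z, v x = v y ∨ v y = v z ∨ v x = v z) :
    (v a ≠ v b ∧ ((∀ x y, σ (Sum.inl x) = Sum.inl y → v x ≠ v y) ∨
      (∀ x y, σ (Sum.inl x) = Sum.inl y → v (Equiv.swap a b x) ≠ v (Equiv.swap a b y)))) ↔
    ∀ x y, capOff (Sum.inl a) (Sum.inl b) σ (Sum.inl x) = Sum.inl y → v x ≠ v y := by
  have hab' : (Sum.inl a : Fin (n + 1) ⊕ Fin (n + 1)) ≠ Sum.inl b := by simpa using hab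
  have hflip : ∀ x y, σ (Sum.inl x) = Sum.inl y → σ (Sum.inl y) = Sum.inl x :=
    fun x y h => by rw [← h, hσ]
  have hsw : ∀ x, x ≠ a → x ≠ b → Equiv.swap a b x = x :=
    fun x h h' => Equiv.swap_apply_of_ne_of_ne h h'
  constructor
  · rintro ⟨h, hor⟩ x y hxy
    by_cases xa : x = a
    · subst xa
      rw [capOff_left, Sum.inl.injEq] at hxy
      rwa [← hxy]
    by_cases xb : x = b
    · subst xb
      rw [capOff_right, Sum.inl.injEq] at hxy
      rw [← hxy]
      exact h.symm
    have xa' : (Sum.inl x : Fin (n + 1) ⊕ Fin (n + 1)) ≠ Sum.inl a := by simpa using xa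
    have xb' : (Sum.inl x : Fin (n + 1) ⊕ Fin (n + 1)) ≠ Sum.inl b := by simpa using xb
    have hyx := capOff_involutive hab' hσ hne (Sum.inl x)
    rw [hxy] at hyx
    have ya : y ≠ a := by
      rintro rfl
      rw [capOff_left] at hyx
      exact xb' hyx.symm
    have yb : y ≠ b := by
      rintro rfl
      rw [capOff_right] at hyx
      exact xa' hyx.symm
    by_cases ha : σ (Sum.inl x) = Sum.inl a
    · rw [capOff_of_left xa' xb' ha] at hxy
      -- With only two colours, `x` and `y` differ from `a` and `b` respectively (in the swapped
      -- case, from `b` and `a`), and `a` and `b` differ, so `x` and `y` differ.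
      have h1 := hv a b
      rcases hor with hor | hor
      · have e1 := hor _ _ ha
        have e2 := hor _ _ hxy
        grind
      · have e1 := hor _ _ ha
        have e2 := hor _ _ hxy
        rw [Equiv.swap_apply_left, hsw x xa xb] at e1
        rw [Equiv.swap_apply_right, hsw y ya yb] at e2
        grind
    by_cases hb : σ (Sum.inl x) = Sum.inl b
    · rw [capOff_of_right hab' xa' xb' hb] at hxy
      have h1 := hv a b
      rcases hor with hor | hor
      · have e1 := hor _ _ hb
        have e2 := hor _ _ hxy
        grind
      · have e1 := hor _ _ hb
        have e2 := hor _ _ hxy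
        rw [Equiv.swap_apply_right, hsw x xa xb] at e1
        rw [Equiv.swap_apply_left, hsw y ya yb] at e2
        grind
    rw [capOff_of_ne xa' xb' ha hb] at hxy
    rcases hor with hor | hor
    · exact hor _ _ hxy
    · have := hor _ _ hxy
      rwa [hsw x xa xb, hsw y ya yb] at this
  · intro h
    have hvab : v a ≠ v b := h _ _ capOff_left
    refine ⟨hvab, ?_⟩
    have hold : ∀ x y, x ≠ a → x ≠ b → y ≠ a → y ≠ b → σ (Sum.inl x) = Sum.inl y →
        v x ≠ v y := by
      intro x y h1 h2 h3 h4 h5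
      refine h x y ?_
      rw [capOff_of_ne] <;> simp [h1, h2, h3, h4, h5]
    have hnew : ∀ x y, x ≠ a → x ≠ b → σ (Sum.inl a) = Sum.inl x → σ (Sum.inl b) = Sum.inl y →
        v x ≠ v y := by
      intro x y h1 h2 h3 h4
      refine h x y ?_
      rw [capOff_of_left (by simpa using h1) (by simpa using h2) (hflip _ _ h3), h4]
    -- it is enough to look at the partners of `a` and `b`
    have crit₁ : (∀ y, σ (Sum.inl a) = Sum.inl y → v a ≠ v y) →
        (∀ y, σ (Sum.inl b) = Sum.inl y → v b ≠ v y) →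
        ∀ x y, σ (Sum.inl x) = Sum.inl y → v x ≠ v y := by
      intro ha hb x y hxy
      by_cases xa : x = a
      · subst xa; exact ha y hxy
      by_cases xb : x = b
      · subst xb; exact hb y hxy
      by_cases ya : y = a
      · subst ya; exact (ha x (hflip _ _ hxy)).symm
      by_cases yb : y = b
      · subst yb; exact (hb x (hflip _ _ hxy)).symm
      exact hold x y xa xb ya yb hxy
    have crit₂ : (∀ y, σ (Sum.inl a) = Sum.inl y → v b ≠ v (Equiv.swap a b y)) →
        (∀ y, σ (Sum.inl b) = Sum.inl y → v a ≠ v (Equiv.swap a b y)) →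
        ∀ x y, σ (Sum.inl x) = Sum.inl y → v (Equiv.swap a b x) ≠ v (Equiv.swap a b y) := by
      intro ha hb x y hxy
      by_cases xa : x = a
      · subst xa; rw [Equiv.swap_apply_left]; exact ha y hxy
      by_cases xb : x = b
      · subst xb; rw [Equiv.swap_apply_right]; exact hb y hxy
      by_cases ya : y = a
      · subst ya; rw [Equiv.swap_apply_left]; exact (ha x (hflip _ _ hxy)).symm
      by_cases yb : y = b
      · subst yb; rw [Equiv.swap_apply_right]; exact (hb x (hflip _ _ hxy)).symm
      rw [hsw x xa xb, hsw y ya yb]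
      exact hold x y xa xb ya yb hxy
    have hself : ∀ x, σ (Sum.inl x) ≠ Sum.inl x := fun x => hne _
    rcases ha : σ (Sum.inl a) with x | x
    · by_cases xb : x = b
      · subst xb
        have hb := hflip _ _ ha
        left
        refine crit₁ (fun y hy => ?_) fun y hy => ?_
        · rw [ha, Sum.inl.injEq] at hy; rwa [← hy]
        · rw [hb, Sum.inl.injEq] at hy; rw [← hy]; exact hvab.symm
      have xa : x ≠ a := by rintro rfl; exact hself _ ha
      -- The partner `x` of `a` decides: if its colour differs from that of `a`, then `v` itself
      -- works, otherwise the swapped colouring does. A partner of `b` among the top points is then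
      -- correctly coloured too, being separated from `x` by the new arc.
      by_cases hvx : v a = v x
      · right
        refine crit₂ (fun y hy => ?_) fun y hy => ?_
        · rw [ha, Sum.inl.injEq] at hy
          rw [← hy, hsw x xa xb, ← hvx]
          exact hvab.symm
        · have yb : y ≠ b := by rintro rfl; exact hself _ hy
          have ya : y ≠ a := by
            rintro rfl
            rw [hflip _ _ hy, Sum.inl.injEq] at ha
            exact xb ha.symm
          rw [hsw y ya yb, hvx]
          exact hnew x y xa xb ha hy
      · left
        refine crit₁ (fun y hy => ?_) fun y hy => ?_
        · rw [ha, Sum.inl.injEq] at hy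
          rwa [← hy]
        · have hxb : v x = v b := by
            rcases hv x a b with h | h | h
            · exact absurd h.symm hvx
            · exact absurd h hvab
            · exact h
          rw [← hxb]
          exact hnew x y xa xb ha hy
    · have hna : ∀ y, σ (Sum.inl a) ≠ Sum.inl y := fun y hy => by rw [ha] at hy; cases hy
      rcases hb : σ (Sum.inl b) with y | y
      · have yb : y ≠ b := by rintro rfl; exact hself _ hb
        have ya : y ≠ a := by rintro rfl; exact hna _ (hflip _ _ hb)
        by_cases hvy : v b = v y
        · right
          refine crit₂ (fun z hz => absurd hz (hna z)) fun z hz => ?_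
          rw [hb, Sum.inl.injEq] at hz
          rwa [← hz, hsw y ya yb, ← hvy]
        · left
          refine crit₁ (fun z hz => absurd hz (hna z)) fun z hz => ?_
          rw [hb, Sum.inl.injEq] at hz
          rwa [← hz]
      · left
        exact crit₁ (fun z hz => absurd hz (hna z)) fun z hz => by rw [hb] at hz; cases hz

variable [CharZero k]

/-- Induction from the empty word, whose diagram has no top cups. The vector `0` is listed apart: it
belongs to every variety but separates no letters. -/
theorem mem_wordVariety (hn : 0 < n) (l : List (Fin n)) {v : Fin (n + 1) → k} :
    v ∈ wordVariety k l ↔ IsTwoValued v ∧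
      (v = 0 ∨ ∀ x y, (wordDiagram l).Adj (Sum.inl x) (Sum.inl y) → v x ≠ v y) := by
  induction l generalizing v with
  | nil =>
    have : ∀ x y : Fin (n + 1), ¬ (wordDiagram ([] : List (Fin n))).Adj (Sum.inl x) (Sum.inl y) := by
      intro x y
      rw [(isMatching_wordDiagram _).adj_iff]
      simp [wordMatching]
    simp only [this, false_imp_iff, implies_true, or_true, and_true]
    exact mem_weylUnion hn
  | cons i l ih =>
    have hs : ∀ x, simpleRefl i (simpleRefl i x) = x := Equiv.swap_apply_self _ _
    rw [mem_wordVariety_cons, ih, ih]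
    have hne : i.castSucc ≠ i.succ := i.castSucc_lt_succ.ne
    rw [simpleRefl, mem_transverseUnion_swap hne, ← simpleRefl]
    have htwo : IsTwoValued (fun x => v (simpleRefl i x)) ↔ IsTwoValued v := by
      have key : ∀ u : Fin (n + 1) → k, IsTwoValued u →
          IsTwoValued (fun x => u (simpleRefl i x)) :=
        fun u hu => ⟨(Equiv.sum_comp (simpleRefl i) u).trans hu.1, fun x y z => hu.2 _ _ _⟩
      exact ⟨fun h => by simpa only [hs] using key _ h, key v⟩
    have hzero : (fun x => v (simpleRefl i x)) = 0 ↔ v = 0 := by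
      constructor
      · intro h
        funext x
        have := congrFun h (simpleRefl i x)
        simpa only [hs, Pi.zero_apply] using this
      · rintro rfl; rfl
    rw [htwo, hzero]
    by_cases h2 : IsTwoValued v
    · by_cases h0 : v = 0
      · simp [h0]
      · have := colouring_capOff (isMatching_wordDiagram l).invol (isMatching_wordDiagram l).ne hne h2.2
        simp only [(isMatching_wordDiagram _).adj_iff, h2, h0, true_and, false_or]
        exact this
    · simp [h2]

theorem mem_inter_transverseUnion (hn : 0 < n) {T : Set (Equiv.Perm (Fin (n + 1)))}
    (hT : ∀ t ∈ T, t.IsSwap) {v : Fin (n + 1) → k} :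
    v ∈ weylUnion k n ∩ (⋂ t ∈ T, transverseUnion k t) ↔ IsTwoValued v ∧
      (v = 0 ∨ ∀ x y, x ≠ y ∧ Equiv.swap x y ∈ T → v x ≠ v y) := by
  rw [Set.mem_inter_iff, mem_weylUnion hn, Set.mem_iInter₂]
  refine and_congr_right fun h2 => ⟨fun h => ?_, fun h t ht => ?_⟩
  · by_cases h0 : v = 0
    · exact Or.inl h0
    · refine Or.inr fun x y hxy => ?_
      exact (((mem_transverseUnion_swap hxy.1).1 (h _ hxy.2)).2).resolve_left h0
  · obtain ⟨x, y, hxy, rfl⟩ := hT t ht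
    exact (mem_transverseUnion_swap hxy).2 ⟨h2, h.imp_right fun h => h x y ⟨hxy, ht⟩⟩

/-- A partial matching, nonempty if `n = 1`, is determined by the vectors of Weyl lines which
separate the matched letters. -/
theorem IsPartialMatching.le_of_forall {C C' : Fin (n + 1) → Fin (n + 1) → Prop}
    (hC : IsPartialMatching C) (h1 : n = 1 → ∃ x y, C x y) (hC' : IsPartialMatching C')
    (h : ∀ v : Fin (n + 1) → k, IsTwoValued v →
      (v = 0 ∨ ∀ x y, C x y → v x ≠ v y) → (v = 0 ∨ ∀ x y, C' x y → v x ≠ v y))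
    {x y : Fin (n + 1)} (hxy : C' x y) : C x y := by
  by_contra hnot
  have hne : x ≠ y := by rintro rfl; exact hC'.irrefl _ hxy
  obtain ⟨p, hp, hpC, a, b, ha, hb⟩ := hC.exists_colouring h1 hne hnot
  obtain ⟨v, hv, hv0, hvp⟩ := exists_isTwoValued (k := k) p ha hb
  have := (h v hv (Or.inr fun a b hab e => hpC a b hab ((hvp a b).1 e))).resolve_left hv0
  exact this x y hxy ((hvp x y).2 hp)

end WordVariety

/-- The top cups of the diagram of a word form a partial matching. -/
theorem isPartialMatching_wordDiagram {n : ℕ} (l : List (Fin n)) :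
    IsPartialMatching fun x y => (wordDiagram l).Adj (Sum.inl x) (Sum.inl y) where
  symm _ _ h := h.symm
  irrefl _ h := h.ne rfl
  unique x y z h h' := by
    rw [(isMatching_wordDiagram l).adj_iff] at h h'
    exact Sum.inl.inj (h.symm.trans h')

theorem exists_adj_wordDiagram {n : ℕ} {l : List (Fin n)} (hl : l ≠ []) :
    ∃ x y, (wordDiagram l).Adj (Sum.inl x) (Sum.inl y) := by
  cases l with
  | nil => exact absurd rfl hl
  | cons i l =>
    exact ⟨i.castSucc, i.succ, ((isMatching_wordDiagram _).adj_iff _ _).2 capOff_left⟩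

theorem isDenseReflSet_topCups {n : ℕ} {l : List (Fin n)} (hl : l ≠ []) :
    IsDenseReflSet (topCups l) :=
  (isPartialMatching_wordDiagram l).isDenseReflSet (fun _ _ _ => planar_cups l)
    (exists_adj_wordDiagram hl)

/-- The reflection set of the variety of a nonempty word, reduced or not, exists, is unique and
consists of the top cups of the diagram of the word. -/
theorem isReflSetOf_wordVariety_iff (k : Type*) [Field k] [CharZero k] {n : ℕ}
    {l : List (Fin n)} (hl : l ≠ []) (T : Set (Equiv.Perm (Fin (n + 1)))) :
    IsReflSetOf k (wordVariety k l) T ↔ T = topCups l := by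
  have hn : 0 < n := by
    obtain ⟨i, -⟩ := List.exists_mem_of_ne_nil l hl
    exact i.pos
  have hC := isPartialMatching_wordDiagram l
  have hex := exists_adj_wordDiagram hl
  have htop : topCups l = reflSet fun x y => (wordDiagram l).Adj (Sum.inl x) (Sum.inl y) := rfl
  constructor
  · rintro ⟨hT, hW, h1⟩
    have hCT := hT.isPartialMatching
    -- For `n = 1` the empty matching and the single arc have the same colourings with both colours
    -- used; nonemptiness tells them apart.
    have h1' : n = 1 → ∃ x y, x ≠ y ∧ Equiv.swap x y ∈ T := by
      intro e
      obtain ⟨t, ht⟩ := h1 e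
      obtain ⟨x, y, hxy, rfl⟩ := hT.1 t ht
      exact ⟨x, y, hxy, ht⟩
    have key : ∀ v : Fin (n + 1) → k, IsTwoValued v →
        ((v = 0 ∨ ∀ x y, (wordDiagram l).Adj (Sum.inl x) (Sum.inl y) → v x ≠ v y) ↔
          (v = 0 ∨ ∀ x y, x ≠ y ∧ Equiv.swap x y ∈ T → v x ≠ v y)) := by
      intro v hv
      have h2 := mem_wordVariety hn l (v := v)
      rw [hW, mem_inter_transverseUnion hn hT.1] at h2
      simpa only [hv, true_and] using h2.symm
    rw [hT.eq_reflSet, htop]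
    congr 1
    funext x y
    exact propext ⟨fun h => hC.le_of_forall (fun _ => hex) hCT (fun v hv => (key v hv).1) h,
      fun h => hCT.le_of_forall h1' hC (fun v hv => (key v hv).2) h⟩
  · rintro rfl
    have hcomm : IsCommutingReflSet (topCups l) := hC.isCommutingReflSet
    refine ⟨hcomm, ?_, fun _ => ?_⟩
    · ext v
      rw [mem_inter_transverseUnion hn hcomm.1, mem_wordVariety hn]
      have : ∀ x y, (x ≠ y ∧ Equiv.swap x y ∈ topCups l) ↔
          (wordDiagram l).Adj (Sum.inl x) (Sum.inl y) := fun x y =>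
        ⟨fun h => (hC.swap_mem_reflSet h.1).1 h.2,
          fun h => ⟨fun e => hC.irrefl x (by rwa [← e] at h), _, _, h, rfl⟩⟩
      simp only [this]
    · obtain ⟨x, y, h⟩ := hex
      exact ⟨_, x, y, h, rfl⟩

end WeylLines

theorem mainTheorem7 (k : Type*) [Field k] [CharZero k] (n : ℕ)
    (w : Equiv.Perm (Fin (n + 1))) (hw : WeylLines.IsFullyCommutative w)
    (l : List (Fin n)) (hl : l ≠ [])
    (hred : WeylLines.IsReduced l) (hprod : WeylLines.wordProd l = w) :
    WeylLines.IsDenseReflSet (WeylLines.topCups l) ∧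
      ∀ T : Set (Equiv.Perm (Fin (n + 1))),
        WeylLines.IsReflSetOf k (WeylLines.wordVariety k l) T ↔ T = WeylLines.topCups l :=
  ⟨WeylLines.isDenseReflSet_topCups hl, WeylLines.isReflSetOf_wordVariety_iff k hl⟩
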